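/- Let $n,m\ge 1$ and let $\mathbf H$ be a random complex $n\times m$ matrix whose entries are i.i.d. zero-mean circularly symmetric complex Gaussian random variables of unit variance (i.i.d. Rayleigh fading). Let $I(1),\dots,I(s)$ be pairwise disjoint non-empty sets (antenna groups) with union $\{1,\dots,m\}$, let $P_T>0$ and $P_1,\dots,P_s>0$, and let $$S_R=\Big\{\mathbf R\in\mathbb C^{m\times m}:\ \mathbf R\ge 0,\ \operatorname{tr}\mathbf R\le P_T,\ \sum_{i\in I(j)}(\mathbf R)_{ii}\le P_j,\ j=1,\dots,s\Big\}$$ be the set of transmit covariance matrices that satisfy the joint total (TPC) and per-group (PGPC) power constraints. Consider the problem $$C^*=\max_{\mathbf R\in S_R}\ \mathbb E_{\mathbf H}\big\{\ln|\mathbf I+\mathbf H\mathbf R\mathbf H^+|\big\},$$ and the following algorithm. Start with $I=\{1,\dots,m\}$, $P=P_T$, $L=m$. While $P/L\ge P_j/|I(j)|$ for at least one group $I(j)\subseteq I$, do the following: for each of the groups $I(j)\subseteq I$ present at the start of the pass, in order of index, if $P/L\ge P_j/|I(j)|$ (with the current $P$ and $L$), set $p_i^*=P_j/|I(j)|$ for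 all $i\in I(j)$ and replace $P$ by $P-P_j$, $L$ by $L-|I(j)|$ and $I$ by $I\setminus I(j)$. When the while loop ends, set $p_i^*=P/L$ for all $i\in I$. Then the expectation is finite for every $\mathbf R\in S_R$, the algorithm halts after finitely many steps, and the problem has exactly one optimal solution $\mathbf R^*$; it is diagonal, and its diagonal entries are the output of the algorithm: $\mathbf R^*=\operatorname{diag}(p_1^*,\dots,p_m^*)$. -/

import Mathlib

open MeasureTheory ProbabilityTheory

namespace RayleighMIMO

/-- The circularly symmetric complex Gaussian law `CN(0,1)`: independent real and imaginary
parts, each real Gaussian with mean `0` and variance `1/2`. -/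
noncomputable def stdComplexGaussian : Measure ℂ :=
  ((gaussianReal 0 (1 / 2)).prod (gaussianReal 0 (1 / 2))).map
    Complex.measurableEquivRealProd.symm

/-- I.i.d. Rayleigh fading: the entries of the random `n × m` channel matrix `H` are independent
and each of them has law `CN(0,1)`. -/
structure IsRayleighFading {Ω : Type*} [MeasurableSpace Ω] (μ : Measure Ω) {n m : ℕ}
    (H : Ω → Matrix (Fin n) (Fin m) ℂ) : Prop where
  indep : iIndepFun (fun (ij : Fin n × Fin m) (ω : Ω) => H ω ij.1 ij.2) μ
  law : ∀ i j, HasLaw (fun ω => H ω i j) stdComplexGaussian μ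

open ComplexOrder in
/-- Covariance matrices that satisfy the total power constraint `PT` and the per-group power
constraints `P j` for the antenna groups `I j`. (Diagonal entries of a positive semidefinite
matrix are real, so taking real parts loses nothing.) -/
def feasibleSet {m s : ℕ} (I : Fin s → Finset (Fin m)) (PT : ℝ) (P : Fin s → ℝ) :
    Set (Matrix (Fin m) (Fin m) ℂ) :=
  {R | R.PosSemidef ∧ R.trace.re ≤ PT ∧ ∀ j, ∑ i ∈ I j, (R i i).re ≤ P j}

/-- `ln |I + H R H⁺|` for a fixed channel matrix `H`. (For positive semidefinite `R` the
determinant is real and at least `1`.) -/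
noncomputable def rate {n m : ℕ} (H : Matrix (Fin n) (Fin m) ℂ)
    (R : Matrix (Fin m) (Fin m) ℂ) : ℝ :=
  Real.log (1 + H * R * H.conjTranspose).det.re

/-- The ergodic rate `E ln |I + H R H⁺|`. -/
noncomputable def ergodicRate {Ω : Type*} [MeasurableSpace Ω] (μ : Measure Ω) {n m : ℕ}
    (H : Ω → Matrix (Fin n) (Fin m) ℂ) (R : Matrix (Fin m) (Fin m) ℂ) : ℝ :=
  ∫ ω, rate (H ω) R ∂μ

/-- `R` solves the problem of maximizing the ergodic rate over the feasible set. -/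
def IsOptimalCovariance {Ω : Type*} [MeasurableSpace Ω] (μ : Measure Ω) {n m s : ℕ}
    (H : Ω → Matrix (Fin n) (Fin m) ℂ) (I : Fin s → Finset (Fin m)) (PT : ℝ) (P : Fin s → ℝ)
    (R : Matrix (Fin m) (Fin m) ℂ) : Prop :=
  R ∈ feasibleSet I PT P ∧ IsMaxOn (ergodicRate μ H) (feasibleSet I PT P) R

/-! ### The power allocation algorithm -/

/-- The program variables: remaining power, remaining number of antennas, the set of remaining
antennas, and the array of allocated powers. -/
structure State (m : ℕ) where
  power : ℝ
  count : ℝ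
  remaining : Finset (Fin m)
  alloc : Fin m → ℝ

/-- Initialization. (The initial contents of the array `alloc` are immaterial.) -/
def State.init (m : ℕ) (PT : ℝ) : State m where
  power := PT
  count := m
  remaining := Finset.univ
  alloc := fun _ => 0

section Algorithm

variable {m s : ℕ} (I : Fin s → Finset (Fin m)) (P : Fin s → ℝ)

/-- The test that declares group `j` active: the average remaining power is at least the average
power that the constraint of group `j` allows. -/
def Test (σ : State m) (j : Fin s) : Prop :=
  P j / ((I j).card : ℝ) ≤ σ.power / σ.count

/-- The condition of the while loop: some remaining group passes the test. -/
def Guard (σ : State m) : Prop :=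
  ∃ j, I j ⊆ σ.remaining ∧ Test I P σ j

open Classical in
/-- The body of the inner for loop, executed for group `j` with the current variables. -/
noncomputable def forBody (σ : State m) (j : Fin s) : State m :=
  if Test I P σ j then
    { power := σ.power - P j
      count := σ.count - ((I j).card : ℝ)
      remaining := σ.remaining \ I j
      alloc := fun i => if i ∈ I j then P j / ((I j).card : ℝ) else σ.alloc i }
  else σ

/-- The inner for loop: the groups that remain when the loop is entered are visited once each, in
increasing order of their index. -/
noncomputable def forLoop (σ : State m) : State m :=
  ((List.finRange s).filter (fun j => decide (I j ⊆ σ.remaining))).foldl (forBody I P) σ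

/-- `WhileRun I P σ τ`: the while loop, started with variables `σ`, halts after finitely many
passes with variables `τ`. -/
inductive WhileRun : State m → State m → Prop
  | halt (σ : State m) : ¬ Guard I P σ → WhileRun σ σ
  | pass (σ τ : State m) : Guard I P σ → WhileRun (forLoop I P σ) τ → WhileRun σ τ

/-- The final for loop: every remaining antenna gets the average remaining power. -/
noncomputable def State.finish (σ : State m) : Fin m → ℝ :=
  fun i => if i ∈ σ.remaining then σ.power / σ.count else σ.alloc i

/-- The algorithm halts with output `p`. -/
def AlgorithmReturns (PT : ℝ) (p : Fin m → ℝ) : Prop :=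
  ∃ τ : State m, WhileRun I P (State.init m PT) τ ∧ p = τ.finish

end Algorithm

end RayleighMIMO

namespace RayleighMIMO

/-! ### Tangent inequality for log det, with its equality case. -/

section LogDet

open ComplexOrder
open scoped Matrix MatrixOrder

variable {n : ℕ}

/-! The proof uses concavity, symmetry and Lagrange multipliers, with the tangent inequality in
place of differentiation. Let D = diag(p) for the output p, and G = Hᴴ(1 + HDHᴴ)⁻¹H. Integrating the
tangent bound for log det at D bounds the rate of any R by that of D plus E Re tr(G(R − D)).

Two symmetries of the law of H control this linear term. Flipping the sign of a column shows that E
G is diagonal, so the term is ∑ gᵢ(Rᵢᵢ − pᵢ) with gᵢ = E Gᵢᵢ ≥ 0. Permuting columns shows that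
swapping two powers preserves the rate; the tangent bound between p and its swap then forces larger
powers to have smaller gᵢ (`powerGradient_antitone`).

The algorithm puts a common maximal level on a union A of groups and saturates every other group
with equal powers (`AlgorithmReturns.spec`). Hence the value c of g on A (0 if A is empty) is a
multiplier for the total constraint, and g − c ≥ 0, constant on each saturated group, supplies the
group multipliers. The linear term is therefore nonpositive, and D is optimal.

If R is also optimal, the tangent bound is an equality almost surely, so H(R − D)Hᴴ = 0 almost
surely; full support of the Gaussian law gives R = D. -/

theorem posDef_log_det_le_trace {C : Matrix (Fin n) (Fin n) ℂ} (hC : C.PosDef) :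
    Real.log C.det.re ≤ C.trace.re - n := by
  have h1 : C.det.re = ∏ i, hC.isHermitian.eigenvalues i := by
    rw [hC.isHermitian.det_eq_prod_eigenvalues]
    norm_cast
  have h2 : C.trace.re = ∑ i, hC.isHermitian.eigenvalues i := by
    rw [hC.isHermitian.trace_eq_sum_eigenvalues]
    norm_cast
  rw [h1, h2, Real.log_prod (fun i _ => (hC.eigenvalues_pos i).ne')]
  have h3 : (n : ℝ) = ∑ _i : Fin n, (1 : ℝ) := by simp
  rw [h3, ← Finset.sum_sub_distrib]
  exact Finset.sum_le_sum fun i _ => Real.log_le_sub_one_of_pos (hC.eigenvalues_pos i)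

theorem posDef_eq_one_of_log_det_eq {C : Matrix (Fin n) (Fin n) ℂ} (hC : C.PosDef)
    (h : Real.log C.det.re = C.trace.re - n) : C = 1 := by
  have h1 : C.det.re = ∏ i, hC.isHermitian.eigenvalues i := by
    rw [hC.isHermitian.det_eq_prod_eigenvalues]
    norm_cast
  have h2 : C.trace.re = ∑ i, hC.isHermitian.eigenvalues i := by
    rw [hC.isHermitian.trace_eq_sum_eigenvalues]
    norm_cast
  have h3 : (n : ℝ) = ∑ _i : Fin n, (1 : ℝ) := by simp
  rw [h1, h2, Real.log_prod (fun i _ => (hC.eigenvalues_pos i).ne'), h3,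
    ← Finset.sum_sub_distrib, Finset.sum_eq_sum_iff_of_le
      (fun i _ => Real.log_le_sub_one_of_pos (hC.eigenvalues_pos i))] at h
  have h4 : hC.isHermitian.eigenvalues = fun _ => (1 : ℝ) := by
    funext i
    by_contra hne
    exact (Real.log_lt_sub_one_of_pos (hC.eigenvalues_pos i) hne).ne (h i (Finset.mem_univ i))
  have h5 := hC.isHermitian.spectral_theorem
  rw [h4] at h5
  rw [h5]
  have : (Matrix.diagonal ((RCLike.ofReal : ℝ → ℂ) ∘ fun _ : Fin n => (1 : ℝ))) = 1 := by
    ext i j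
    simp [Matrix.diagonal, Matrix.one_apply]
  rw [this, map_one]

theorem posDef_det_re_pos {A : Matrix (Fin n) (Fin n) ℂ} (hA : A.PosDef) : 0 < A.det.re :=
  (Complex.pos_iff.1 hA.det_pos).1

theorem posDef_det_im {A : Matrix (Fin n) (Fin n) ℂ} (hA : A.PosDef) : A.det.im = 0 :=
  (Complex.pos_iff.1 hA.det_pos).2.symm

/-- Whitening: for positive definite `A`, `B` there is a positive definite `C` congruent to `B`
that behaves like `A⁻¹ B` as far as determinant and trace are concerned. -/
theorem exists_posDef_whitening {A B : Matrix (Fin n) (Fin n) ℂ} (hA : A.PosDef)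
    (hB : B.PosDef) : ∃ C : Matrix (Fin n) (Fin n) ℂ, C.PosDef ∧
      Real.log C.det.re = Real.log B.det.re - Real.log A.det.re ∧
      C.trace = (A⁻¹ * B).trace ∧ (C = 1 → B = A) := by
  -- With A = KᴴK, the witness is C = (K⁻¹)ᴴ B K⁻¹.
  obtain ⟨K, hKA⟩ := CStarAlgebra.nonneg_iff_eq_star_mul_self.mp hA.posSemidef.nonneg
  rw [Matrix.star_eq_conjTranspose] at hKA
  have hK : IsUnit K := by
    have := (Matrix.isUnit_iff_isUnit_det A).1 hA.isUnit
    rw [hKA, Matrix.det_mul] at this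
    exact (Matrix.isUnit_iff_isUnit_det K).2 (isUnit_of_mul_isUnit_right this)
  subst hKA
  have hKd : IsUnit K.det := (Matrix.isUnit_iff_isUnit_det K).1 hK
  have hKhd : IsUnit Kᴴ.det := by rw [Matrix.det_conjTranspose]; exact hKd.star
  have hC : ((K⁻¹)ᴴ * B * K⁻¹).PosDef := by
    refine hB.conjTranspose_mul_mul_same ?_
    exact Matrix.mulVec_injective_of_isUnit ((Matrix.isUnit_nonsing_inv_iff).2 hK)
  have hdet : ((K⁻¹)ᴴ * B * K⁻¹).det * (Kᴴ * K).det = B.det := by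
    simp only [Matrix.det_mul, Matrix.det_conjTranspose, Matrix.det_nonsing_inv,
      Ring.inverse_eq_inv']
    have h0 := hKd.ne_zero
    have h1 : star K.det ≠ 0 := by simpa using h0
    rw [star_inv₀]
    field_simp
  refine ⟨(K⁻¹)ᴴ * B * K⁻¹, hC, ?_, ?_, ?_⟩
  · rw [← hdet, Complex.mul_re, posDef_det_im hC, zero_mul, sub_zero,
      Real.log_mul (posDef_det_re_pos hC).ne' (posDef_det_re_pos hA).ne']
    ring
  · rw [Matrix.mul_inv_rev, Matrix.trace_mul_comm, ← Matrix.conjTranspose_nonsing_inv,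
      Matrix.mul_assoc]
  · intro h
    have h' : Kᴴ * ((K⁻¹)ᴴ * B * K⁻¹) * K = B := by
      rw [Matrix.conjTranspose_nonsing_inv, ← Matrix.mul_assoc, ← Matrix.mul_assoc,
        Matrix.mul_nonsing_inv _ hKhd, Matrix.one_mul, Matrix.mul_assoc,
        Matrix.nonsing_inv_mul _ hKd, Matrix.mul_one]
    rw [← h', h, Matrix.mul_one]

theorem trace_inv_mul_self_re {A : Matrix (Fin n) (Fin n) ℂ} (hA : A.PosDef) :
    (A⁻¹ * A).trace.re = n := by
  rw [Matrix.nonsing_inv_mul _ ((Matrix.isUnit_iff_isUnit_det A).1 hA.isUnit)]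
  simp

/-- The tangent inequality for the concave function `log det`. -/
theorem log_det_le_tangent {A B : Matrix (Fin n) (Fin n) ℂ} (hA : A.PosDef) (hB : B.PosDef) :
    Real.log B.det.re ≤ Real.log A.det.re + (A⁻¹ * (B - A)).trace.re := by
  obtain ⟨C, hC, h1, h2, -⟩ := exists_posDef_whitening hA hB
  have h := posDef_log_det_le_trace hC
  rw [Matrix.mul_sub, Matrix.trace_sub, Complex.sub_re, trace_inv_mul_self_re hA, ← h2]
  linarith

theorem eq_of_log_det_eq_tangent {A B : Matrix (Fin n) (Fin n) ℂ} (hA : A.PosDef)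
    (hB : B.PosDef) (h : Real.log B.det.re = Real.log A.det.re + (A⁻¹ * (B - A)).trace.re) :
    B = A := by
  obtain ⟨C, hC, h1, h2, h3⟩ := exists_posDef_whitening hA hB
  rw [Matrix.mul_sub, Matrix.trace_sub, Complex.sub_re, trace_inv_mul_self_re hA, ← h2] at h
  exact h3 (posDef_eq_one_of_log_det_eq hC (by linarith))

theorem posDef_one_add {X : Matrix (Fin n) (Fin n) ℂ} (hX : X.PosSemidef) : (1 + X).PosDef :=
  Matrix.PosDef.one.add_posSemidef hX

/-- For N = (1 + X)⁻¹, N = N(1 + X)N = NNᴴ + NᴴXN, so row a of N has squared norm at most Nₐₐ. This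
gives first |Nₐₐ| ≤ 1, then the bound on the whole row. -/
theorem norm_inv_one_add_apply_le_one {X : Matrix (Fin n) (Fin n) ℂ} (hX : X.PosSemidef)
    (a b : Fin n) : ‖(1 + X)⁻¹ a b‖ ≤ 1 := by
  have hA := posDef_one_add hX
  set N := (1 + X)⁻¹ with hN
  have hNH : Nᴴ = N := hA.inv.isHermitian
  have hu := (Matrix.isUnit_iff_isUnit_det _).1 hA.isUnit
  have h1 : N = N * Nᴴ + Nᴴ * X * N := by
    have : N * (1 + X) * N = N := by
      rw [hN, Matrix.nonsing_inv_mul _ hu, Matrix.one_mul]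
    rw [hNH]
    nth_rw 1 [← this]
    rw [Matrix.mul_add, Matrix.add_mul, Matrix.mul_one]
  have h2 : ∑ k, ‖N a k‖ ^ 2 ≤ (N a a).re := by
    have h3 : 0 ≤ ((Nᴴ * X * N) a a).re :=
      (Complex.nonneg_iff.1 ((hX.conjTranspose_mul_mul_same N).diag_nonneg (i := a))).1
    have h4 : ((N * Nᴴ) a a).re = ∑ k, ‖N a k‖ ^ 2 := by
      rw [Matrix.mul_apply, Complex.re_sum]
      refine Finset.sum_congr rfl fun k _ => ?_
      rw [Matrix.conjTranspose_apply, RCLike.star_def, Complex.mul_conj, Complex.ofReal_re,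
        Complex.normSq_eq_norm_sq]
    have h5 := congrArg (fun M : Matrix (Fin n) (Fin n) ℂ => (M a a).re) h1
    simp only [Matrix.add_apply, Complex.add_re] at h5
    linarith
  have h6 : ∀ k, ‖N a k‖ ^ 2 ≤ ‖N a a‖ := fun k =>
    (Finset.single_le_sum (f := fun k => ‖N a k‖ ^ 2) (fun _ _ => by positivity)
      (Finset.mem_univ k)).trans (h2.trans (Complex.re_le_norm _))
  have h7 : ‖N a a‖ ≤ 1 := by nlinarith [h6 a, norm_nonneg (N a a)]
  nlinarith [h6 b, norm_nonneg (N a b)]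

end LogDet

/-! ### Support, second moment and sign symmetry of CN(0,1). -/

section Gaussian

instance : IsProbabilityMeasure stdComplexGaussian :=
  Measure.isProbabilityMeasure_map Complex.measurableEquivRealProd.symm.measurable.aemeasurable

instance : stdComplexGaussian.IsOpenPosMeasure := by
  have : (gaussianReal 0 (1 / 2)).IsOpenPosMeasure :=
    (gaussianReal_absolutelyContinuous' 0 (by norm_num)).isOpenPosMeasure
  exact Complex.equivRealProdCLM.symm.continuous.isOpenPosMeasure_map
    Complex.equivRealProdCLM.symm.surjective

theorem memLp_id_stdComplexGaussian : MemLp id 2 stdComplexGaussian := by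
  rw [stdComplexGaussian, memLp_map_measure_iff (by fun_prop)
    Complex.measurableEquivRealProd.symm.measurable.aemeasurable]
  have h : MemLp (id : ℝ → ℝ) 2 (gaussianReal 0 (1 / 2)) := memLp_id_gaussianReal 2
  have h1 := (h.comp_measurePreserving (measurePreserving_fst (ν := gaussianReal 0 (1 / 2)))).ofReal
    (K := ℂ)
  have h2 := (h.comp_measurePreserving (measurePreserving_snd (μ := gaussianReal 0 (1 / 2)))).ofReal
    (K := ℂ)
  refine (h1.add (h2.const_mul Complex.I)).ae_eq (Filter.Eventually.of_forall fun x => ?_)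
  apply Complex.ext <;> simp [Complex.measurableEquivRealProd]

theorem stdComplexGaussian_map_neg :
    stdComplexGaussian.map (fun z => -z) = stdComplexGaussian := by
  have h : MeasurePreserving (fun x : ℝ => -x) (gaussianReal 0 (1 / 2)) (gaussianReal 0 (1 / 2)) :=
    ⟨measurable_neg, by rw [gaussianReal_map_neg, neg_zero]⟩
  have h2 := (h.prod h).map_eq
  rw [stdComplexGaussian, Measure.map_map measurable_neg (MeasurableEquiv.measurable _)]
  nth_rw 2 [← h2]
  rw [Measure.map_map (MeasurableEquiv.measurable _) (h.prod h).measurable]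
  congr 1

end Gaussian

/-! ### Invariances and nondegeneracy of the channel law. -/

namespace IsRayleighFading

variable {Ω : Type*} [MeasurableSpace Ω] {μ : Measure Ω} {n m : ℕ}
  {H H' : Ω → Matrix (Fin n) (Fin m) ℂ}

theorem hasLaw_pi (hH : IsRayleighFading μ H) :
    HasLaw (fun ω (ij : Fin n × Fin m) => H ω ij.1 ij.2)
      (Measure.pi fun _ => stdComplexGaussian) μ :=
  hH.indep.hasLaw_pi fun ij => hH.law ij.1 ij.2

theorem memLp (hH : IsRayleighFading μ H) (i : Fin n) (j : Fin m) :
    MemLp (fun ω => H ω i j) 2 μ := by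
  have h := memLp_id_stdComplexGaussian
  rw [← (hH.law i j).map_eq, memLp_map_measure_iff (by fun_prop) (hH.law i j).aemeasurable] at h
  exact h

/-- Functions of the channel matrix that are measurable as functions of its entries. -/
theorem aestronglyMeasurable (hH : IsRayleighFading μ H) {E : Type*} [TopologicalSpace E]
    [TopologicalSpace.PseudoMetrizableSpace E] [SecondCountableTopology E] [MeasurableSpace E]
    [OpensMeasurableSpace E] {g : Matrix (Fin n) (Fin m) ℂ → E}
    (hg : Measurable fun x : Fin n × Fin m → ℂ => g (Matrix.of fun i j => x (i, j))) :
    AEStronglyMeasurable (fun ω => g (H ω)) μ :=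
  (hg.comp_aemeasurable hH.hasLaw_pi.aemeasurable).aestronglyMeasurable

theorem integral_eq (hH : IsRayleighFading μ H) (hH' : IsRayleighFading μ H')
    {E : Type*} [NormedAddCommGroup E] [NormedSpace ℝ E] [SecondCountableTopology E]
    [MeasurableSpace E] [BorelSpace E] {g : Matrix (Fin n) (Fin m) ℂ → E}
    (hg : Measurable fun x : Fin n × Fin m → ℂ => g (Matrix.of fun i j => x (i, j))) :
    ∫ ω, g (H ω) ∂μ = ∫ ω, g (H' ω) ∂μ :=
  (hH.hasLaw_pi.integral_comp hg.aestronglyMeasurable).trans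
    (hH'.hasLaw_pi.integral_comp hg.aestronglyMeasurable).symm

theorem submatrix (hH : IsRayleighFading μ H) (e : Equiv.Perm (Fin m)) :
    IsRayleighFading μ (fun ω => (H ω).submatrix id e) where
  indep := hH.indep.precomp (g := fun ij : Fin n × Fin m => (ij.1, e ij.2)) (by
    rintro ⟨a, b⟩ ⟨c, d⟩ h
    simpa using h)
  law i j := hH.law i (e j)

theorem mul_diagonal (hH : IsRayleighFading μ H) {d : Fin m → ℂ} (hd : ∀ i, d i = 1 ∨ d i = -1) :
    IsRayleighFading μ (fun ω => H ω * Matrix.diagonal d) where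
  indep := by
    simp only [Matrix.mul_diagonal]
    exact hH.indep.comp (fun ij z => z * d ij.2) fun ij => measurable_id.mul_const _
  law i j := by
    simp only [Matrix.mul_diagonal]
    rcases hd j with h | h
    · simpa [h] using hH.law i j
    · simp only [h, mul_neg, mul_one]
      exact HasLaw.comp (Y := fun z : ℂ => -z)
        ⟨measurable_neg.aemeasurable, stdComplexGaussian_map_neg⟩ (hH.law i j)

/-- A continuous function vanishing almost everywhere for a measure of full support vanishes
identically. So v ↦ ∑ vₗ Dₗₖ v̄ₖ is zero for every row v, and polarization gives D = 0. -/
theorem eq_zero_of_quadratic_ae_eq_zero (hH : IsRayleighFading μ H) (a : Fin n)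
    {D : Matrix (Fin m) (Fin m) ℂ} (h : ∀ᵐ ω ∂μ, (H ω * D * (H ω).conjTranspose) a a = 0) :
    D = 0 := by
  have hc : Continuous fun x : Fin n × Fin m → ℂ =>
      ((Matrix.of fun i j => x (i, j)) * D *
        (Matrix.of fun i j => x (i, j)).conjTranspose) a a := by
    simp only [Matrix.mul_apply, Matrix.conjTranspose_apply, Matrix.of_apply]
    fun_prop
  have h1 : (fun x : Fin n × Fin m → ℂ =>
      ((Matrix.of fun i j => x (i, j)) * D *
        (Matrix.of fun i j => x (i, j)).conjTranspose) a a)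
        =ᵐ[Measure.pi fun _ => stdComplexGaussian] fun _ => 0 := by
    refine (hH.hasLaw_pi.ae_iff (p := fun x => ((Matrix.of fun i j => x (i, j)) * D *
        (Matrix.of fun i j => x (i, j)).conjTranspose) a a = 0) ?_).1 h
    exact measurableSet_setOfPred.1 (hc.measurable (measurableSet_singleton 0))
  have h2 := (Continuous.ae_eq_iff_eq _ hc continuous_const).1 h1
  have h3 : ∀ v : Fin m → ℂ, ∑ k, (∑ l, v l * D l k) * star (v k) = 0 := by
    intro v
    have := congrFun h2 (fun ij => v ij.2)
    simpa [Matrix.mul_apply] using this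
  have hdiag : ∀ i, D i i = 0 := fun i => by
    simpa [Pi.single_apply] using h3 (Pi.single i 1)
  ext i k
  by_cases hik : i = k
  · subst hik
    simpa using hdiag i
  -- These test vectors give Dᵢₖ + Dₖᵢ = 0 and, after multiplication by the imaginary unit, Dᵢₖ −
  -- Dₖᵢ = 0.
  have e1 := h3 (Pi.single i 1 + Pi.single k 1)
  have e2 := h3 (Pi.single i 1 + Pi.single k Complex.I)
  simp [Pi.single_apply, add_mul, mul_add, Finset.sum_add_distrib, hdiag,
    apply_ite (starRingEnd ℂ)] at e1 e2
  have e3 := congrArg (Complex.I * ·) e2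
  simp only [Matrix.zero_apply]
  have hI := Complex.I_mul_I
  grind

end IsRayleighFading

/-! ### Pointwise rate: tangent bound, domination, symmetries. -/

section Tangent

open ComplexOrder
open scoped Matrix

variable {n m : ℕ}

/-- The gradient `H⁺ (I + H R H⁺)⁻¹ H` of `R ↦ ln |I + H R H⁺|`. -/
noncomputable def rateGradient (H : Matrix (Fin n) (Fin m) ℂ) (R : Matrix (Fin m) (Fin m) ℂ) :
    Matrix (Fin m) (Fin m) ℂ :=
  Hᴴ * (1 + H * R * Hᴴ)⁻¹ * H

theorem posDef_one_add_mul_mul (H : Matrix (Fin n) (Fin m) ℂ) {R : Matrix (Fin m) (Fin m) ℂ}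
    (hR : R.PosSemidef) : (1 + H * R * Hᴴ).PosDef :=
  posDef_one_add (hR.mul_mul_conjTranspose_same H)

theorem trace_inv_mul_sub (H : Matrix (Fin n) (Fin m) ℂ) (Q R : Matrix (Fin m) (Fin m) ℂ) :
    ((1 + H * Q * Hᴴ)⁻¹ * ((1 + H * R * Hᴴ) - (1 + H * Q * Hᴴ))).trace =
      (rateGradient H Q * (R - Q)).trace := by
  have h : (1 + H * R * Hᴴ) - (1 + H * Q * Hᴴ) = H * (R - Q) * Hᴴ := by
    rw [Matrix.mul_sub, Matrix.sub_mul]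
    abel
  rw [h, rateGradient, ← Matrix.mul_assoc, Matrix.trace_mul_comm]
  simp only [Matrix.mul_assoc]

theorem rate_le_tangent (H : Matrix (Fin n) (Fin m) ℂ) {Q R : Matrix (Fin m) (Fin m) ℂ}
    (hQ : Q.PosSemidef) (hR : R.PosSemidef) :
    rate H R ≤ rate H Q + (rateGradient H Q * (R - Q)).trace.re := by
  rw [← trace_inv_mul_sub]
  exact log_det_le_tangent (posDef_one_add_mul_mul H hQ) (posDef_one_add_mul_mul H hR)

theorem mul_sub_mul_eq_zero_of_rate_eq_tangent (H : Matrix (Fin n) (Fin m) ℂ)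
    {Q R : Matrix (Fin m) (Fin m) ℂ} (hQ : Q.PosSemidef) (hR : R.PosSemidef)
    (h : rate H R = rate H Q + (rateGradient H Q * (R - Q)).trace.re) :
    H * (R - Q) * Hᴴ = 0 := by
  rw [← trace_inv_mul_sub] at h
  have := eq_of_log_det_eq_tangent (posDef_one_add_mul_mul H hQ) (posDef_one_add_mul_mul H hR) h
  rw [Matrix.mul_sub, Matrix.sub_mul, sub_eq_zero]
  exact add_left_cancel this

theorem posSemidef_rateGradient (H : Matrix (Fin n) (Fin m) ℂ) {R : Matrix (Fin m) (Fin m) ℂ}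
    (hR : R.PosSemidef) : (rateGradient H R).PosSemidef :=
  (posDef_one_add_mul_mul H hR).inv.posSemidef.conjTranspose_mul_mul_same H

theorem rate_zero (H : Matrix (Fin n) (Fin m) ℂ) : rate H 0 = 0 := by
  simp [rate]

/-- The tangent at R, evaluated at 0, reduces this to tr(X(1 + X)⁻¹) ≥ 0 for X = HRHᴴ. -/
theorem rate_nonneg (H : Matrix (Fin n) (Fin m) ℂ) {R : Matrix (Fin m) (Fin m) ℂ}
    (hR : R.PosSemidef) : 0 ≤ rate H R := by
  have h := rate_le_tangent H hR Matrix.PosSemidef.zero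
  have h2 : 0 ≤ (rateGradient H R * R).trace.re := by
    have h3 : (rateGradient H R * R).trace = (H * R * Hᴴ * (1 + H * R * Hᴴ)⁻¹).trace := by
      rw [rateGradient, Matrix.mul_assoc, Matrix.mul_assoc, Matrix.trace_mul_comm,
        Matrix.mul_assoc, Matrix.trace_mul_comm, Matrix.mul_assoc, Matrix.mul_assoc]
    have hA := posDef_one_add_mul_mul H hR
    have hu := (Matrix.isUnit_iff_isUnit_det _).1 hA.isUnit
    set N := (1 + H * R * Hᴴ)⁻¹ with hN
    set X := H * R * Hᴴ with hX
    have hXp : X.PosSemidef := hR.mul_mul_conjTranspose_same H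
    have hNH : Nᴴ = N := hA.inv.isHermitian
    -- Inserting N(1 + X) = 1 on the left writes XN as a sum of two positive semidefinite matrices.
    have h4 : X * N = N * X * Nᴴ + (X * N)ᴴ * (X * N) := by
      have e1 : N * (1 + X) = 1 := Matrix.nonsing_inv_mul _ hu
      rw [Matrix.conjTranspose_mul, hNH, hXp.isHermitian.eq]
      calc X * N = N * (1 + X) * (X * N) := by rw [e1, Matrix.one_mul]
        _ = _ := by rw [Matrix.mul_add, Matrix.mul_one, Matrix.add_mul, Matrix.mul_assoc N X N]
    rw [h3, h4]
    have h5 := ((hXp.mul_mul_conjTranspose_same N).add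
      (Matrix.posSemidef_conjTranspose_mul_self (X * N))).trace_nonneg
    exact (Complex.nonneg_iff.1 h5).1
  rw [rate_zero, zero_sub, Matrix.mul_neg, Matrix.trace_neg, Complex.neg_re] at h
  linarith

theorem norm_rateGradient_apply_le (H : Matrix (Fin n) (Fin m) ℂ)
    {R : Matrix (Fin m) (Fin m) ℂ} (hR : R.PosSemidef) (i k : Fin m) :
    ‖rateGradient H R i k‖ ≤ ∑ b, ∑ a, ‖H a i‖ * ‖H b k‖ := by
  rw [rateGradient, Matrix.mul_apply]
  refine (norm_sum_le _ _).trans (Finset.sum_le_sum fun b _ => ?_)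
  rw [Matrix.mul_apply, Finset.sum_mul]
  refine (norm_sum_le _ _).trans (Finset.sum_le_sum fun a _ => ?_)
  rw [norm_mul, norm_mul, Matrix.conjTranspose_apply, norm_star]
  have := norm_inv_one_add_apply_le_one (hR.mul_mul_conjTranspose_same H) a b
  gcongr
  exact mul_le_of_le_one_right (norm_nonneg _) this

theorem continuous_one_add_mul_mul (R : Matrix (Fin m) (Fin m) ℂ) :
    Continuous fun x : Fin n × Fin m → ℂ => (1 + (Matrix.of fun i j => x (i, j)) * R *
      (Matrix.of fun i j => x (i, j))ᴴ : Matrix (Fin n) (Fin n) ℂ) := by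
  have h : Continuous fun x : Fin n × Fin m → ℂ =>
      (Matrix.of fun i j => x (i, j) : Matrix (Fin n) (Fin m) ℂ) :=
    continuous_matrix fun i j => continuous_apply (i, j)
  exact continuous_const.add ((h.matrix_mul continuous_const).matrix_mul h.matrix_conjTranspose)

theorem measurable_rate (R : Matrix (Fin m) (Fin m) ℂ) :
    Measurable fun x : Fin n × Fin m → ℂ => rate (Matrix.of fun i j => x (i, j)) R :=
  Real.measurable_log.comp
    (Complex.continuous_re.comp (continuous_one_add_mul_mul R).matrix_det).measurable

theorem measurable_rateGradient_apply (R : Matrix (Fin m) (Fin m) ℂ) (i k : Fin m) :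
    Measurable fun x : Fin n × Fin m → ℂ =>
      rateGradient (Matrix.of fun i j => x (i, j)) R i k := by
  have h : ∀ a b, Measurable fun x : Fin n × Fin m → ℂ =>
      (1 + (Matrix.of fun i j => x (i, j)) * R *
        (Matrix.of fun i j => x (i, j))ᴴ : Matrix (Fin n) (Fin n) ℂ)⁻¹ a b := by
    intro a b
    -- The adjugate formula also covers singular matrices, where the inverse is 0 by convention, so
    -- R need not be positive semidefinite.
    simp only [Matrix.inv_def, Ring.inverse_eq_inv', Matrix.smul_apply, smul_eq_mul]
    have hc := continuous_one_add_mul_mul (n := n) R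
    exact hc.matrix_det.measurable.inv.mul (hc.matrix_adjugate.matrix_elem a b).measurable
  unfold rateGradient
  simp only [Matrix.mul_apply (M := _ * _), Matrix.mul_apply (M := Matrix.conjTranspose _),
    Matrix.conjTranspose_apply, Matrix.of_apply]
  refine Finset.measurable_sum _ fun b _ => (Finset.measurable_sum _ fun a _ => ?_).mul
    (measurable_pi_apply _)
  exact (continuous_star.comp (continuous_apply (a, i))).measurable.mul (h a b)

/-! ### Column permutations and column sign changes -/

theorem submatrix_mul_diagonal_mul (H : Matrix (Fin n) (Fin m) ℂ) (e : Equiv.Perm (Fin m))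
    (d : Fin m → ℂ) :
    H.submatrix id e * Matrix.diagonal (d ∘ e) * (H.submatrix id e)ᴴ =
      H * Matrix.diagonal d * Hᴴ := by
  ext a b
  simp only [Matrix.mul_apply (M := _ * _), Matrix.mul_diagonal, Matrix.conjTranspose_apply,
    Matrix.submatrix_apply, id, Function.comp_apply]
  exact Equiv.sum_comp e fun k => H a k * d k * star (H b k)

theorem rate_submatrix (H : Matrix (Fin n) (Fin m) ℂ) (e : Equiv.Perm (Fin m))
    (d : Fin m → ℂ) :
    rate (H.submatrix id e) (Matrix.diagonal (d ∘ e)) = rate H (Matrix.diagonal d) := by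
  rw [rate, submatrix_mul_diagonal_mul, rate]

theorem rateGradient_submatrix_apply (H : Matrix (Fin n) (Fin m) ℂ) (e : Equiv.Perm (Fin m))
    (d : Fin m → ℂ) (i k : Fin m) :
    rateGradient (H.submatrix id e) (Matrix.diagonal (d ∘ e)) i k =
      rateGradient H (Matrix.diagonal d) (e i) (e k) := by
  rw [rateGradient, submatrix_mul_diagonal_mul, rateGradient]
  simp [Matrix.mul_apply]

theorem rateGradient_mul_diagonal_apply (H : Matrix (Fin n) (Fin m) ℂ) {s : Fin m → ℂ}
    (hs : ∀ i, s i = 1 ∨ s i = -1) (d : Fin m → ℂ) (i k : Fin m) :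
    rateGradient (H * Matrix.diagonal s) (Matrix.diagonal d) i k =
      s i * rateGradient H (Matrix.diagonal d) i k * s k := by
  have hstar : ∀ i, star (s i) = s i := fun i => by rcases hs i with h | h <;> simp [h]
  have hsq : ∀ i, s i * s i = 1 := fun i => by rcases hs i with h | h <;> simp [h]
  have h : H * Matrix.diagonal s * Matrix.diagonal d * (H * Matrix.diagonal s)ᴴ =
      H * Matrix.diagonal d * Hᴴ := by
    ext a b
    rw [Matrix.mul_apply, Matrix.mul_apply]
    simp only [Matrix.mul_diagonal, Matrix.conjTranspose_apply, star_mul, hstar]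
    refine Finset.sum_congr rfl fun k _ => ?_
    linear_combination (H a k * d k * star (H b k)) * hsq k
  rw [rateGradient, h, rateGradient, ← Matrix.mul_assoc, Matrix.mul_diagonal]
  congr 1
  rw [Matrix.conjTranspose_mul, Matrix.diagonal_conjTranspose, Matrix.mul_assoc _ Hᴴ,
    Matrix.mul_assoc _ _ H, Matrix.diagonal_mul, Pi.star_apply, hstar]

end Tangent

/-! ### Ergodic rate: integrated tangent bound and ordering of its gradient. -/

section Ergodic

open ComplexOrder
open scoped Matrix

variable {Ω : Type*} [MeasurableSpace Ω] {μ : Measure Ω} {n m : ℕ}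
  {H : Ω → Matrix (Fin n) (Fin m) ℂ}

theorem integrable_rateGradient_apply (hH : IsRayleighFading μ H)
    {R : Matrix (Fin m) (Fin m) ℂ} (hR : R.PosSemidef) (i k : Fin m) :
    Integrable (fun ω => rateGradient (H ω) R i k) μ := by
  have h : Integrable (fun ω => ∑ b, ∑ a, ‖H ω a i‖ * ‖H ω b k‖) μ :=
    integrable_finsetSum _ fun b _ => integrable_finsetSum _ fun a _ =>
      (hH.memLp a i).norm.integrable_mul (hH.memLp b k).norm
  exact h.mono' (hH.aestronglyMeasurable (g := fun H => rateGradient H R i k)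
    (measurable_rateGradient_apply R i k))
    (Filter.Eventually.of_forall fun ω => norm_rateGradient_apply_le (H ω) hR i k)

theorem integrable_trace_rateGradient_mul (hH : IsRayleighFading μ H)
    {R : Matrix (Fin m) (Fin m) ℂ} (hR : R.PosSemidef) (D : Matrix (Fin m) (Fin m) ℂ) :
    Integrable (fun ω => (rateGradient (H ω) R * D).trace) μ := by
  simp only [Matrix.trace, Matrix.diag_apply, Matrix.mul_apply]
  exact integrable_finsetSum _ fun i _ => integrable_finsetSum _ fun k _ =>
    (integrable_rateGradient_apply hH hR i k).mul_const _

/-- The rate lies between 0 and its tangent at covariance 0, namely Re tr(HᴴHR), which is quadratic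
in square-integrable entries. -/
theorem integrable_rate (hH : IsRayleighFading μ H) {R : Matrix (Fin m) (Fin m) ℂ}
    (hR : R.PosSemidef) : Integrable (fun ω => rate (H ω) R) μ := by
  refine (integrable_trace_rateGradient_mul hH Matrix.PosSemidef.zero R).re.mono'
    (hH.aestronglyMeasurable (g := fun H => rate H R) (measurable_rate R)) (Filter.Eventually.of_forall fun ω => ?_)
  have h := rate_le_tangent (H ω) Matrix.PosSemidef.zero hR
  rw [rate_zero, zero_add, sub_zero] at h
  rw [Real.norm_of_nonneg (rate_nonneg _ hR)]
  exact h

/-- Flipping the sign of column i preserves the law of H and negates this entry, so its mean equals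
its own negative. -/
theorem integral_rateGradient_apply_of_ne (hH : IsRayleighFading μ H) (d : Fin m → ℂ)
    {i k : Fin m} (hik : i ≠ k) :
    ∫ ω, rateGradient (H ω) (Matrix.diagonal d) i k ∂μ = 0 := by
  have hs : ∀ l, (fun l => if l = i then (-1 : ℂ) else 1) l = 1 ∨
      (fun l => if l = i then (-1 : ℂ) else 1) l = -1 := fun l => by
    by_cases h : l = i <;> simp [h]
  have h := hH.integral_eq (hH.mul_diagonal hs)
    (g := fun H => rateGradient H (Matrix.diagonal d) i k)
    (measurable_rateGradient_apply (Matrix.diagonal d) i k)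
  simp only [rateGradient_mul_diagonal_apply _ hs, if_true, if_neg hik.symm, mul_one,
    neg_one_mul, integral_neg] at h
  exact self_eq_neg.1 h

/-- The gradient, with respect to the powers, of the ergodic rate at a diagonal covariance. -/
noncomputable def powerGradient (μ : Measure Ω) (H : Ω → Matrix (Fin n) (Fin m) ℂ)
    (p : Fin m → ℝ) (i : Fin m) : ℝ :=
  ∫ ω, (rateGradient (H ω) (Matrix.diagonal fun i => (p i : ℂ)) i i).re ∂μ

theorem posSemidef_diagonal_ofReal {p : Fin m → ℝ} (hp : ∀ i, 0 ≤ p i) :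
    (Matrix.diagonal fun i => (p i : ℂ)).PosSemidef :=
  Matrix.PosSemidef.diagonal fun i => by simpa using hp i

theorem integral_trace_rateGradient_mul (hH : IsRayleighFading μ H) {p : Fin m → ℝ}
    (hp : ∀ i, 0 ≤ p i) {D : Matrix (Fin m) (Fin m) ℂ} (hD : ∀ i, (D i i).im = 0) :
    ∫ ω, (rateGradient (H ω) (Matrix.diagonal fun i => (p i : ℂ)) * D).trace.re ∂μ =
      ∑ i, powerGradient μ H p i * (D i i).re := by
  have hR := posSemidef_diagonal_ofReal hp
  have hint := integrable_rateGradient_apply hH hR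
  have h1 : ∫ ω, (rateGradient (H ω) (Matrix.diagonal fun i => (p i : ℂ)) * D).trace ∂μ =
      ∑ i, (∫ ω, rateGradient (H ω) (Matrix.diagonal fun i => (p i : ℂ)) i i ∂μ) * D i i := by
    simp only [Matrix.trace, Matrix.diag_apply, Matrix.mul_apply]
    rw [integral_finsetSum _ fun i _ => integrable_finsetSum _ fun k _ => (hint i k).mul_const _]
    refine Finset.sum_congr rfl fun i _ => ?_
    rw [integral_finsetSum _ fun k _ => (hint i k).mul_const _, Finset.sum_eq_single i]
    · rw [integral_mul_const]
    · intro k _ hki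
      rw [integral_mul_const, integral_rateGradient_apply_of_ne hH _ hki.symm, zero_mul]
    · simp
  have h2 := integral_re (𝕜 := ℂ) (integrable_trace_rateGradient_mul hH hR D)
  refine h2.trans ?_
  rw [h1, map_sum]
  refine Finset.sum_congr rfl fun i _ => ?_
  have h3 := integral_re (𝕜 := ℂ) (hint i i)
  rw [powerGradient]
  refine Eq.trans ?_ (congrArg (· * (D i i).re) h3.symm)
  simp [hD i]

theorem integral_tangent (hH : IsRayleighFading μ H) {p : Fin m → ℝ}
    (hp : ∀ i, 0 ≤ p i) {R : Matrix (Fin m) (Fin m) ℂ} (hR : R.PosSemidef) :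
    ∫ ω, (rate (H ω) (Matrix.diagonal fun i => (p i : ℂ)) +
        (rateGradient (H ω) (Matrix.diagonal fun i => (p i : ℂ)) *
          (R - Matrix.diagonal fun i => (p i : ℂ))).trace.re) ∂μ =
      ergodicRate μ H (Matrix.diagonal fun i => (p i : ℂ)) +
        ∑ i, powerGradient μ H p i * ((R i i).re - p i) := by
  have hQ := posSemidef_diagonal_ofReal hp
  refine (integral_add (integrable_rate hH hQ)
    (integrable_trace_rateGradient_mul hH hQ _).re).trans ?_
  refine (congrArg (_ + ·) (integral_trace_rateGradient_mul hH hp ?_)).trans ?_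
  rotate_left
  · simp [ergodicRate]
  · intro i
    simpa using (Complex.nonneg_iff.1 (hR.diag_nonneg (i := i))).2.symm

theorem ergodicRate_le_tangent (hH : IsRayleighFading μ H) {p : Fin m → ℝ}
    (hp : ∀ i, 0 ≤ p i) {R : Matrix (Fin m) (Fin m) ℂ} (hR : R.PosSemidef) :
    ergodicRate μ H R ≤ ergodicRate μ H (Matrix.diagonal fun i => (p i : ℂ)) +
      ∑ i, powerGradient μ H p i * ((R i i).re - p i) := by
  have hQ := posSemidef_diagonal_ofReal hp
  rw [← integral_tangent hH hp hR]
  exact integral_mono (integrable_rate hH hR)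
    ((integrable_rate hH hQ).add (integrable_trace_rateGradient_mul hH hQ _).re)
    fun ω => rate_le_tangent (H ω) hQ hR

theorem eq_diagonal_of_ergodicRate_eq_tangent (hn : 0 < n) (hH : IsRayleighFading μ H)
    {p : Fin m → ℝ} (hp : ∀ i, 0 ≤ p i) {R : Matrix (Fin m) (Fin m) ℂ} (hR : R.PosSemidef)
    (h : ergodicRate μ H R = ergodicRate μ H (Matrix.diagonal fun i => (p i : ℂ)) +
      ∑ i, powerGradient μ H p i * ((R i i).re - p i)) :
    R = Matrix.diagonal fun i => (p i : ℂ) := by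
  have hQ := posSemidef_diagonal_ofReal hp
  rw [← integral_tangent hH hp hR] at h
  have h1 := (integral_eq_iff_of_ae_le (integrable_rate hH hR)
    ((integrable_rate hH hQ).add (integrable_trace_rateGradient_mul hH hQ _).re)
    (Filter.Eventually.of_forall fun ω => rate_le_tangent (H ω) hQ hR)).1 h
  refine sub_eq_zero.1 (hH.eq_zero_of_quadratic_ae_eq_zero ⟨0, hn⟩ ?_)
  filter_upwards [h1] with ω hω
  rw [mul_sub_mul_eq_zero_of_rate_eq_tangent (H ω) hQ hR hω, Matrix.zero_apply]

theorem powerGradient_nonneg {p : Fin m → ℝ} (hp : ∀ i, 0 ≤ p i) (i : Fin m) :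
    0 ≤ powerGradient μ H p i :=
  integral_nonneg fun ω => (Complex.nonneg_iff.1
    ((posSemidef_rateGradient (H ω) (posSemidef_diagonal_ofReal hp)).diag_nonneg (i := i))).1

theorem ergodicRate_diagonal_comp (hH : IsRayleighFading μ H) (p : Fin m → ℝ)
    (e : Equiv.Perm (Fin m)) :
    ergodicRate μ H (Matrix.diagonal fun i => (p (e i) : ℂ)) =
      ergodicRate μ H (Matrix.diagonal fun i => (p i : ℂ)) := by
  refine (hH.integral_eq (hH.submatrix e)
    (g := fun H => rate H (Matrix.diagonal fun i => (p (e i) : ℂ))) (measurable_rate _)).trans ?_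
  exact integral_congr_ae (Filter.Eventually.of_forall fun ω =>
    rate_submatrix (H ω) e fun i => (p i : ℂ))

theorem powerGradient_comp (hH : IsRayleighFading μ H) (p : Fin m → ℝ)
    (e : Equiv.Perm (Fin m)) (i : Fin m) :
    powerGradient μ H (fun i => p (e i)) i = powerGradient μ H p (e i) := by
  refine (hH.integral_eq (hH.submatrix e)
    (g := fun H => (rateGradient H (Matrix.diagonal fun i => (p (e i) : ℂ)) i i).re)
    (Complex.measurable_re.comp (measurable_rateGradient_apply _ i i))).trans ?_
  exact integral_congr_ae (Filter.Eventually.of_forall fun ω =>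
    congrArg Complex.re (rateGradient_submatrix_apply (H ω) e (fun i => (p i : ℂ)) i i))

/-- Swapping the powers i and k leaves the ergodic rate unchanged, so the tangent bound at p reads 0
≤ (gᵢ − gₖ)(pₖ − pᵢ). Equal powers are treated separately by invariance of p under the swap. -/
theorem powerGradient_antitone (hH : IsRayleighFading μ H) {p : Fin m → ℝ}
    (hp : ∀ i, 0 ≤ p i) {i k : Fin m} (hik : p i ≤ p k) :
    powerGradient μ H p k ≤ powerGradient μ H p i := by
  have hswap : ∀ l, p (Equiv.swap i k l) = if l = i then p k else if l = k then p i else p l := by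
    intro l
    rw [Equiv.swap_apply_def]
    split_ifs <;> rfl
  rcases hik.eq_or_lt with h | h
  · have hpe : (fun l => p (Equiv.swap i k l)) = p := by
      funext l
      rw [hswap]
      split_ifs with h1 h2
      · rw [h1, h]
      · rw [h2, h]
      · rfl
    have := powerGradient_comp hH p (Equiv.swap i k) i
    rw [hpe, Equiv.swap_apply_left] at this
    exact this.ge
  · have hne : i ≠ k := fun hik => by simp [hik] at h
    have h1 := ergodicRate_le_tangent hH hp
      (posSemidef_diagonal_ofReal (p := fun l => p (Equiv.swap i k l)) fun l => hp _)
    rw [ergodicRate_diagonal_comp hH p] at h1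
    have h2 : ∑ l, powerGradient μ H p l *
        (((Matrix.diagonal fun l => ((p (Equiv.swap i k l) : ℝ) : ℂ)) l l).re - p l) =
        powerGradient μ H p i * (p k - p i) + powerGradient μ H p k * (p i - p k) := by
      rw [Fintype.sum_eq_add i k hne]
      · simp
      · rintro l ⟨hl1, hl2⟩
        simp [Equiv.swap_apply_of_ne_of_ne hl1 hl2]
    rw [h2] at h1
    nlinarith

end Ergodic

/-! ### Loop invariant, termination and output of the algorithm. -/

section AlgorithmAnalysis

variable {m s : ℕ} {I : Fin s → Finset (Fin m)} {P : Fin s → ℝ} {PT : ℝ}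

/-- The loop invariant: the groups are kept or removed as a whole, removed groups are allocated
exactly the power their constraint allows, and their average power is at most the average
remaining power. -/
structure Invariant (I : Fin s → Finset (Fin m)) (P : Fin s → ℝ) (PT : ℝ) (σ : State m) :
    Prop where
  power_nonneg : 0 ≤ σ.power
  count_eq : σ.count = σ.remaining.card
  power_add : σ.power + ∑ i ∈ σ.remainingᶜ, σ.alloc i = PT
  subset_or : ∀ j, I j ⊆ σ.remaining ∨
    (Disjoint (I j) σ.remaining ∧ (∀ i ∈ I j, σ.alloc i = P j / (I j).card) ∧
      P j / (I j).card * σ.count ≤ σ.power)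

theorem Invariant.init (hPT : 0 < PT) : Invariant I P PT (State.init m PT) where
  power_nonneg := hPT.le
  count_eq := by simp [State.init]
  power_add := by simp [State.init]
  subset_or j := Or.inl (by simp [State.init])

theorem forBody_remaining_subset (σ : State m) (j : Fin s) :
    (forBody I P σ j).remaining ⊆ σ.remaining := by
  unfold forBody
  split_ifs
  · exact Finset.sdiff_subset
  · exact subset_rfl

theorem foldl_forBody_remaining_subset (l : List (Fin s)) (σ : State m) :
    (l.foldl (forBody I P) σ).remaining ⊆ σ.remaining := by
  induction l generalizing σ with
  | nil => exact subset_rfl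
  | cons j l ih => exact (ih _).trans (forBody_remaining_subset σ j)

/-- Removing a group whose average is at most the current average cannot lower the average of what
remains, so earlier removals stay below it. Multiplying out by the count covers the case where no
antenna remains. -/
theorem Invariant.forBody (hI : ∀ j, (I j).Nonempty)
    (hd : ∀ j k, j ≠ k → Disjoint (I j) (I k)) {σ : State m} (h : Invariant I P PT σ)
    {j : Fin s} (hj : I j ⊆ σ.remaining) : Invariant I P PT (forBody I P σ j) := by
  unfold RayleighMIMO.forBody
  split_ifs with ht
  swap
  · exact h
  have hc : (0 : ℝ) < (I j).card := by exact_mod_cast (hI j).card_pos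
  have hle : ((I j).card : ℝ) ≤ σ.remaining.card := by exact_mod_cast Finset.card_le_card hj
  have hcount : 0 < σ.count := by rw [h.count_eq]; linarith
  have hPj : P j / (I j).card * (I j).card = P j := div_mul_cancel₀ _ hc.ne'
  unfold Test at ht
  rw [le_div_iff₀ hcount] at ht
  have hle' : ((I j).card : ℝ) ≤ σ.count := by rw [h.count_eq]; exact hle
  have hmain : P j / (I j).card * (σ.count - (I j).card) ≤ σ.power - P j := by linarith
  refine ⟨?_, ?_, ?_, ?_⟩
  · change 0 ≤ σ.power - P j
    -- No sign of `P j` is assumed: if it is negative, subtracting it increases the power.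
    by_cases hneg : 0 ≤ P j / (I j).card
    · exact (mul_nonneg hneg (by linarith)).trans hmain
    · have := h.power_nonneg
      nlinarith
  · change σ.count - (I j).card = ((σ.remaining \ I j).card : ℝ)
    rw [Finset.card_sdiff_of_subset hj, Nat.cast_sub (Finset.card_le_card hj), h.count_eq]
  · change σ.power - P j + ∑ i ∈ (σ.remaining \ I j)ᶜ,
      (if i ∈ I j then P j / ((I j).card : ℝ) else σ.alloc i) = PT
    have hu : (σ.remaining \ I j)ᶜ = σ.remainingᶜ ∪ I j := by
      ext i
      simp only [Finset.mem_compl, Finset.mem_sdiff, Finset.mem_union]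
      tauto
    have hdis : Disjoint σ.remainingᶜ (I j) :=
      Finset.disjoint_left.2 fun i hi hij => Finset.mem_compl.1 hi (hj hij)
    rw [hu, Finset.sum_union hdis,
      Finset.sum_congr rfl fun i hi => if_neg (Finset.disjoint_left.1 hdis hi),
      Finset.sum_congr (s₁ := I j) rfl fun i hi => if_pos hi, Finset.sum_const, nsmul_eq_mul,
      ← h.power_add]
    linarith
  · intro k
    by_cases hk : k = j
    · subst hk
      right
      refine ⟨Finset.disjoint_sdiff, fun i hi => if_pos hi, hmain⟩
    rcases h.subset_or k with h1 | ⟨h1, h2, h3⟩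
    · left
      exact Finset.subset_sdiff.2 ⟨h1, hd k j hk⟩
    · right
      refine ⟨h1.mono_right Finset.sdiff_subset, fun i hi => ?_, ?_⟩
      · change (if i ∈ I j then P j / ((I j).card : ℝ) else σ.alloc i) = _
        rw [if_neg (Finset.disjoint_left.1 (hd k j hk) hi), h2 i hi]
      · change P k / (I k).card * (σ.count - (I j).card) ≤ σ.power - P j
        rcases le_total (P k / (I k).card) (P j / (I j).card) with hab | hab
        · exact (mul_le_mul_of_nonneg_right hab (by linarith)).trans hmain
        · nlinarith

theorem subset_forBody_remaining (hd : ∀ j k, j ≠ k → Disjoint (I j) (I k)) {σ : State m}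
    {j k : Fin s} (hkj : k ≠ j) (hk : I k ⊆ σ.remaining) :
    I k ⊆ (forBody I P σ j).remaining := by
  unfold forBody
  split_ifs
  · exact Finset.subset_sdiff.2 ⟨hk, hd k j hkj⟩
  · exact hk

theorem Invariant.foldl (hI : ∀ j, (I j).Nonempty)
    (hd : ∀ j k, j ≠ k → Disjoint (I j) (I k)) (l : List (Fin s)) (hl : l.Nodup) {σ : State m}
    (h : Invariant I P PT σ) (hs : ∀ j ∈ l, I j ⊆ σ.remaining) :
    Invariant I P PT (l.foldl (RayleighMIMO.forBody I P) σ) := by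
  induction l generalizing σ with
  | nil => exact h
  | cons j l ih =>
    rw [List.nodup_cons] at hl
    refine ih hl.2 (h.forBody hI hd (hs j (by simp))) fun k hk => ?_
    exact subset_forBody_remaining hd (fun hkj => hl.1 (hkj ▸ hk)) (hs k (by simp [hk]))

theorem Invariant.forLoop (hI : ∀ j, (I j).Nonempty)
    (hd : ∀ j k, j ≠ k → Disjoint (I j) (I k)) {σ : State m} (h : Invariant I P PT σ) :
    Invariant I P PT (forLoop I P σ) :=
  h.foldl hI hd _ ((List.nodup_finRange s).filter _) fun j hj => by simpa using hj

/-- Until some group passes, the state is unchanged, so the given passing test stays valid; the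
first group to pass is nonempty and is removed. -/
theorem foldl_forBody_remaining_ssubset (hI : ∀ j, (I j).Nonempty) (l : List (Fin s))
    {σ : State m} (hs : ∀ j ∈ l, I j ⊆ σ.remaining) (ht : ∃ j ∈ l, Test I P σ j) :
    (l.foldl (forBody I P) σ).remaining ⊂ σ.remaining := by
  induction l with
  | nil => simp at ht
  | cons j l ih =>
    rw [List.foldl_cons]
    by_cases hj : Test I P σ j
    · refine (foldl_forBody_remaining_subset l _).trans_ssubset ?_
      rw [forBody, if_pos hj]
      exact Finset.sdiff_ssubset (hs j (by simp)) (hI j)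
    · rw [forBody, if_neg hj]
      refine ih (fun k hk => hs k (by simp [hk])) ?_
      obtain ⟨k, hk, hkt⟩ := ht
      rcases List.mem_cons.1 hk with rfl | hk
      · exact absurd hkt hj
      · exact ⟨k, hk, hkt⟩

theorem forLoop_remaining_ssubset (hI : ∀ j, (I j).Nonempty) {σ : State m} (h : Guard I P σ) :
    (forLoop I P σ).remaining ⊂ σ.remaining := by
  obtain ⟨j, hj, ht⟩ := h
  exact foldl_forBody_remaining_ssubset hI _ (fun j hj => by simpa using hj)
    ⟨j, by simpa using hj, ht⟩

theorem exists_whileRun (hI : ∀ j, (I j).Nonempty) (σ : State m) :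
    ∃ τ, WhileRun I P σ τ := by
  induction hc : σ.remaining.card using Nat.strong_induction_on generalizing σ with
  | _ c ih =>
    by_cases hg : Guard I P σ
    · obtain ⟨τ, hτ⟩ := ih _ (hc ▸ Finset.card_lt_card (forLoop_remaining_ssubset hI hg)) _ rfl
      exact ⟨τ, WhileRun.pass σ τ hg hτ⟩
    · exact ⟨σ, WhileRun.halt σ hg⟩

theorem WhileRun.not_guard {σ τ : State m} (h : WhileRun I P σ τ) : ¬ Guard I P τ := by
  induction h with
  | halt σ hg => exact hg
  | pass σ τ _ _ ih => exact ih

theorem WhileRun.invariant (hI : ∀ j, (I j).Nonempty)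
    (hd : ∀ j k, j ≠ k → Disjoint (I j) (I k)) {σ τ : State m} (h : WhileRun I P σ τ)
    (hσ : Invariant I P PT σ) : Invariant I P PT τ := by
  induction h with
  | halt σ _ => exact hσ
  | pass σ τ _ _ ih => exact ih (hσ.forLoop hI hd)

/-- What characterizes the output `p` of the algorithm: it is feasible, there is a set `A` of
antennas, a union of groups, that share a common level not exceeded by the other antennas, and the
remaining groups meet their constraints with equal powers. -/
theorem AlgorithmReturns.spec (hI : ∀ j, (I j).Nonempty)
    (hd : ∀ j k, j ≠ k → Disjoint (I j) (I k)) (hcov : ∀ i, ∃ j, i ∈ I j) (hPT : 0 < PT)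
    (hP : ∀ j, 0 < P j) {p : Fin m → ℝ} (h : AlgorithmReturns I P PT p) :
    (∀ i, 0 ≤ p i) ∧ ∑ i, p i ≤ PT ∧ (∀ j, ∑ i ∈ I j, p i ≤ P j) ∧
    ∃ A : Finset (Fin m), (A.Nonempty → ∑ i, p i = PT) ∧ (∀ i ∈ A, ∀ k, p k ≤ p i) ∧
      ∀ j, I j ⊆ A ∨ Disjoint (I j) A ∧ (∀ i ∈ I j, ∀ k ∈ I j, p i = p k) ∧
        ∑ i ∈ I j, p i = P j := by
  obtain ⟨τ, hrun, rfl⟩ := h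
  have hinv := hrun.invariant hI hd (Invariant.init (I := I) (P := P) hPT)
  have hng := hrun.not_guard
  have hcard : ∀ j, (0 : ℝ) < (I j).card := fun j => by exact_mod_cast (hI j).card_pos
  have hin : ∀ i ∈ τ.remaining, τ.finish i = τ.power / τ.count := fun i hi => if_pos hi
  have hout : ∀ i ∉ τ.remaining, τ.finish i = τ.alloc i := fun i hi => if_neg hi
  have hrem : ∀ j, Disjoint (I j) τ.remaining →
      (∀ i ∈ I j, τ.alloc i = P j / (I j).card) → ∀ i ∈ I j, τ.finish i = P j / (I j).card :=
    fun j hj ha i hi => (hout i (Finset.disjoint_left.1 hj hi)).trans (ha i hi)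
  have hcount : 0 ≤ τ.count := by rw [hinv.count_eq]; positivity
  have hsum : ∑ i, τ.finish i = τ.count * (τ.power / τ.count) + (PT - τ.power) := by
    rw [← Finset.sum_add_sum_compl τ.remaining, Finset.sum_congr rfl hin, Finset.sum_const,
      nsmul_eq_mul, ← hinv.count_eq, ← hinv.power_add,
      Finset.sum_congr rfl fun i hi => hout i (Finset.mem_compl.1 hi)]
    ring
  have hgsum : ∀ j, Disjoint (I j) τ.remaining →
      (∀ i ∈ I j, τ.alloc i = P j / (I j).card) → ∑ i ∈ I j, τ.finish i = P j := by
    intro j hj ha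
    rw [Finset.sum_congr rfl (hrem j hj ha), Finset.sum_const, nsmul_eq_mul,
      mul_div_cancel₀ _ (hcard j).ne']
  refine ⟨fun i => ?_, ?_, fun j => ?_, τ.remaining, fun hne => ?_, fun i hi k => ?_, fun j => ?_⟩
  · by_cases hi : i ∈ τ.remaining
    · rw [hin i hi]
      exact div_nonneg hinv.power_nonneg hcount
    · obtain ⟨j, hj⟩ := hcov i
      rcases hinv.subset_or j with h1 | ⟨h1, h2, -⟩
      · exact absurd (h1 hj) hi
      · rw [hrem j h1 h2 i hj]
        exact (div_pos (hP j) (hcard j)).le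
  · rcases hcount.eq_or_lt with h0 | h0
    · rw [hsum, ← h0, zero_mul]
      linarith [hinv.power_nonneg]
    · rw [hsum, mul_div_cancel₀ _ h0.ne']
      linarith
  · rcases hinv.subset_or j with h1 | ⟨h1, h2, -⟩
    · rw [Finset.sum_congr rfl fun i hi => hin i (h1 hi), Finset.sum_const, nsmul_eq_mul]
      have : τ.power / τ.count < P j / (I j).card := not_le.1 fun hle => hng ⟨j, h1, hle⟩
      rw [lt_div_iff₀ (hcard j)] at this
      linarith
    · exact (hgsum j h1 h2).le
  · have : 0 < τ.count := by rw [hinv.count_eq]; exact_mod_cast hne.card_pos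
    rw [hsum, mul_div_cancel₀ _ this.ne']
    ring
  · have : 0 < τ.count := by rw [hinv.count_eq]; exact_mod_cast Finset.card_pos.2 ⟨i, hi⟩
    rw [hin i hi]
    by_cases hk : k ∈ τ.remaining
    · exact (hin k hk).le
    · obtain ⟨j, hj⟩ := hcov k
      rcases hinv.subset_or j with h1 | ⟨h1, h2, h3⟩
      · exact absurd (h1 hj) hk
      · rw [hrem j h1 h2 k hj, le_div_iff₀ this]
        exact h3
  · rcases hinv.subset_or j with h1 | ⟨h1, h2, -⟩
    · exact Or.inl h1
    · exact Or.inr ⟨h1, fun i hi k hk => (hrem j h1 h2 i hi).trans (hrem j h1 h2 k hk).symm,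
        hgsum j h1 h2⟩

end AlgorithmAnalysis

/-- First-order optimality: for nonnegative weights that are ordered oppositely to the output `p`
of the algorithm, `p` maximizes the weighted sum of the powers over the feasible powers. -/
theorem AlgorithmReturns.sum_mul_sub_nonpos {m s : ℕ} {I : Fin s → Finset (Fin m)}
    {P : Fin s → ℝ} {PT : ℝ} (hI : ∀ j, (I j).Nonempty)
    (hd : ∀ j k, j ≠ k → Disjoint (I j) (I k)) (hcov : ∀ i, ∃ j, i ∈ I j) (hPT : 0 < PT)
    (hP : ∀ j, 0 < P j) {p : Fin m → ℝ} (h : AlgorithmReturns I P PT p) {g r : Fin m → ℝ}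
    (hg : ∀ i, 0 ≤ g i) (hanti : ∀ i k, p i ≤ p k → g k ≤ g i) (hr : ∑ i, r i ≤ PT)
    (hrP : ∀ j, ∑ i ∈ I j, r i ≤ P j) : ∑ i, g i * (r i - p i) ≤ 0 := by
  obtain ⟨-, -, -, A, hAsum, hAmax, hgrp⟩ := h.spec hI hd hcov hPT hP
  -- c is the multiplier of the total power constraint; `hc1` combines its sign with complementary
  -- slackness.
  obtain ⟨c, hc1, hc2, hc3⟩ : ∃ c : ℝ, c * (∑ i, r i - ∑ i, p i) ≤ 0 ∧ (∀ i ∈ A, g i = c) ∧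
      ∀ i, c ≤ g i := by
    rcases A.eq_empty_or_nonempty with rfl | ⟨a, ha⟩
    · exact ⟨0, by simp, by simp, hg⟩
    · refine ⟨g a, ?_, fun i hi => ?_, fun i => hanti i a (hAmax a ha i)⟩
      · rw [hAsum ⟨a, ha⟩]
        exact mul_nonpos_of_nonneg_of_nonpos (hg a) (by linarith)
      · exact le_antisymm (hanti a i (hAmax i hi a)) (hanti i a (hAmax a ha i))
  have hpart : ∑ i, (g i - c) * (r i - p i) = ∑ j, ∑ i ∈ I j, (g i - c) * (r i - p i) := by
    rw [← Finset.sum_biUnion fun j _ k _ hjk => hd j k hjk]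
    refine Finset.sum_congr (Finset.ext fun i => ?_) fun _ _ => rfl
    simpa using hcov i
  have hle : ∑ j, ∑ i ∈ I j, (g i - c) * (r i - p i) ≤ 0 := by
    refine Finset.sum_nonpos fun j _ => ?_
    rcases hgrp j with h1 | ⟨-, h2, h3⟩
    · refine (Finset.sum_eq_zero fun i hi => ?_).le
      rw [hc2 i (h1 hi), sub_self, zero_mul]
    · obtain ⟨a, ha⟩ := hI j
      have : ∀ i ∈ I j, (g i - c) * (r i - p i) = (g a - c) * (r i - p i) := fun i hi => by
        rw [le_antisymm (hanti a i (h2 a ha i hi).le) (hanti i a (h2 i hi a ha).le)]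
      rw [Finset.sum_congr rfl this, ← Finset.mul_sum, Finset.sum_sub_distrib, h3]
      exact mul_nonpos_of_nonneg_of_nonpos (sub_nonneg.2 (hc3 a)) (sub_nonpos.2 (hrP j))
  have hsplit : ∑ i, g i * (r i - p i) =
      ∑ i, (g i - c) * (r i - p i) + c * (∑ i, r i - ∑ i, p i) := by
    rw [← Finset.sum_sub_distrib, Finset.mul_sum, ← Finset.sum_add_distrib]
    exact Finset.sum_congr rfl fun i _ => by ring
  linarith

end RayleighMIMO

/-! ### Optimality and uniqueness. -/

theorem proposition7 {Ω : Type*} [MeasurableSpace Ω] (μ : Measure Ω) [IsProbabilityMeasure μ]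
    (n m s : ℕ) (hn : 0 < n)
    (H : Ω → Matrix (Fin n) (Fin m) ℂ) (hH : RayleighMIMO.IsRayleighFading μ H)
    (I : Fin s → Finset (Fin m)) (hI_nonempty : ∀ j, (I j).Nonempty)
    (hI_disjoint : ∀ j k, j ≠ k → Disjoint (I j) (I k)) (hI_cover : ∀ i, ∃ j, i ∈ I j)
    (PT : ℝ) (hPT : 0 < PT) (P : Fin s → ℝ) (hP : ∀ j, 0 < P j) :
    -- the objective is a genuine expectation on the whole feasible set
    (∀ R ∈ RayleighMIMO.feasibleSet I PT P,
      Integrable (fun ω => RayleighMIMO.rate (H ω) R) μ) ∧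
    -- the algorithm halts
    (∃ p : Fin m → ℝ, RayleighMIMO.AlgorithmReturns I P PT p) ∧
    -- the diagonal matrix with the returned entries is the one and only optimal covariance
    (∀ p : Fin m → ℝ, RayleighMIMO.AlgorithmReturns I P PT p →
      ∀ R : Matrix (Fin m) (Fin m) ℂ,
        RayleighMIMO.IsOptimalCovariance μ H I PT P R ↔
          R = Matrix.diagonal (fun i => (p i : ℂ))) := by
  refine ⟨fun R hR => RayleighMIMO.integrable_rate hH hR.1, ?_, fun p hp R => ?_⟩
  · obtain ⟨τ, hτ⟩ := RayleighMIMO.exists_whileRun hI_nonempty (P := P)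
      (RayleighMIMO.State.init m PT)
    exact ⟨τ.finish, τ, hτ, rfl⟩
  obtain ⟨hp0, hpT, hpP, -⟩ := hp.spec hI_nonempty hI_disjoint hI_cover hPT hP
  have hmem : (Matrix.diagonal fun i => (p i : ℂ)) ∈ RayleighMIMO.feasibleSet I PT P :=
    ⟨RayleighMIMO.posSemidef_diagonal_ofReal hp0, by simpa [Matrix.trace] using hpT,
      fun j => by simpa using hpP j⟩
  have hsum : ∀ Q ∈ RayleighMIMO.feasibleSet I PT P,
      ∑ i, RayleighMIMO.powerGradient μ H p i * ((Q i i).re - p i) ≤ 0 := fun Q hQ =>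
    hp.sum_mul_sub_nonpos hI_nonempty hI_disjoint hI_cover hPT hP
      (RayleighMIMO.powerGradient_nonneg hp0)
      (fun i k => RayleighMIMO.powerGradient_antitone hH hp0)
      (by simpa [Matrix.trace] using hQ.2.1) hQ.2.2
  constructor
  · rintro ⟨hR, hmax⟩
    have h1 := RayleighMIMO.ergodicRate_le_tangent hH hp0 hR.1
    have h2 := hmax hmem
    have h3 := hsum R hR
    simp only [Set.mem_ofPred_eq] at h2
    -- The tangent value is at most the rate of D, hence at most that of R, hence at most the
    -- tangent value: all are equal.
    exact RayleighMIMO.eq_diagonal_of_ergodicRate_eq_tangent hn hH hp0 hR.1 (by linarith)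
  · rintro rfl
    refine ⟨hmem, fun Q hQ => ?_⟩
    have h1 := RayleighMIMO.ergodicRate_le_tangent hH hp0 hQ.1
    have h2 := hsum Q hQ
    simp only [Set.mem_ofPred_eq]
    linarith
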